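/- Let $\mathcal P$ be a finite set of processes, with a unidirectional channel $(p,q)$ for all $p,q\in\mathcal P$, and let $\mathsf{Value}$ be an arbitrary set. **Failures and quorums.** A *failure pattern* is a pair $f=(P,C)$ of a set $P$ of processes and a set $C$ of channels between processes not in $P$; the processes outside $P$ are *correct according to $f$*. A *fail-prone system* $\mathcal F$ is a set of failure patterns. The residual graph $\mathcal G\setminus f$ is the directed graph of all processes and channels with the processes of $P$, their incident channels and the channels of $C$ removed. A set $Q\subseteq\mathcal P$ is *$f$-available* if $Q\cap P=\emptyset$ and any two members of $Q$ are connected by directed paths of $\mathcal G\setminus f$ in both directions. $W$ is *$f$-reachable from $R$* if $(W\cup R)\cap P=\emptyset$ and every member of $R$ has a directed path in $\mathcal G\setminus f$ to every member of $W$. A *generalized quorum system* is a triple $(\mathcal F,\mathcal R,\mathcal W)$, where $\mathcal R,\mathcal W\subseteq 2^{\mathcal P}$, such that $R\cap W\ne\emptyset$ for all $R\in\mathcal R$, $W\in\mathcal W$, and for every $f\in\mathcal F$ there are $W\in\mathcal W$, $R\in\mathcal R$ such that $W$ is $f$-available and $f$-reachable from $R$. In that case $U_f$ denotes the strongly connected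 component of $\mathcal G\setminus f$ that contains all $f$-available $W\in\mathcal W$ that are $f$-reachable from some $R\in\mathcal R$. **Model.** Processes run deterministic message-passing algorithms that react, in steps taking no time, to invocations, message receipts, expiry of a local timer, and spontaneously. A timer may be started with any positive whole number of local clock units as its duration. In an execution, processes may crash (a process is *correct* if it never does), and channels may disconnect, i.e. drop all messages sent through them from some point on (a channel is *correct* if it never does). Messages are not created or duplicated, and every message sent by a correct process to a correct process on a correct channel is eventually received. An execution is *$f$-compliant*, for $f=(P,C)$, if only processes in $P$ crash and only channels in $C$ or incident to $P$ disconnect; it is *fair* if every correct process takes infinitely many steps. In the *partially synchronous model*, for each execution there are a time $\mathsf{GST}$ and a bound $\delta>0$, both unknown to the algorithm, such that every message sent at or after $\mathsf{GST}$ by a correct process to a correct process on a correct channel is received within $\delta$ of its transmission, and from $\mathsf{GST}$ on local clocks do not drift and running timers of correct processes expire exactly when due. Before $\mathsf{GST}$, message delays and clock drifts are arbitrary (clocks never run backwards, and no timer expires before the local clock reaches its deadline). **Consensus.** The object has one operation $\mathsf{propose}(x)$, $x\in\mathsf{Value}$, returning an element of $\mathsf{Value}$; a process may invoke it whenever its previous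 invocation has returned. An implementation must satisfy, in all executions (whatever the failures and the timing): values are returned only to pending invocations; all returned values are equal (Agreement); every returned value was passed to some $\mathsf{propose}$ invocation (Validity). Given $\tau:\mathcal F\to 2^{\mathcal P}$, it is *$(\mathcal F,\tau)$-wait-free* if for every $f\in\mathcal F$, in every fair $f$-compliant execution of the partially synchronous model, every operation invoked by a process in $\tau(f)$ eventually returns. **Theorem.** Let $(\mathcal F,\mathcal R,\mathcal W)$ be a generalized quorum system and let $\tau(f)=U_f$ for every $f\in\mathcal F$. Then there exists an $(\mathcal F,\tau)$-wait-free implementation of consensus in the partially synchronous model. -/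

import Mathlib

namespace GQS

universe u v

/-! ### Failure patterns and generalized quorum systems -/

/-- A failure pattern: the set of processes and the set of channels that are allowed to fail in a
single execution. There is a channel `(p, q)` for all `p` and `q`; only channels between
processes outside `procs` are listed in `chans`. -/
structure FailurePattern (P : Type u) where
  procs : Set P
  chans : Set (P × P)
  chans_correct : ∀ p q, (p, q) ∈ chans → p ∉ procs ∧ q ∉ procs

variable {P : Type u} {V : Type v}

/-- The edges of the residual graph: the channels that remain after removing the processes of `f`,
their incident channels, and the channels of `f`. -/
def FailurePattern.Edge (f : FailurePattern P) (p q : P) : Prop :=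
  p ∉ f.procs ∧ q ∉ f.procs ∧ (p, q) ∉ f.chans

/-- There is a (possibly empty) directed path from `p` to `q` in the residual graph. -/
def FailurePattern.Path (f : FailurePattern P) (p q : P) : Prop :=
  p ∉ f.procs ∧ q ∉ f.procs ∧ Relation.ReflTransGen f.Edge p q

/-- `Q` is `f`-available: all its members are correct according to `f`, and it is strongly
connected in the residual graph. -/
def FailurePattern.Available (f : FailurePattern P) (Q : Set P) : Prop :=
  (∀ p ∈ Q, p ∉ f.procs) ∧ ∀ p ∈ Q, ∀ q ∈ Q, f.Path p q

/-- `W` is `f`-reachable from `R`. -/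
def FailurePattern.ReachableFrom (f : FailurePattern P) (W R : Set P) : Prop :=
  (∀ p ∈ W, p ∉ f.procs) ∧ (∀ p ∈ R, p ∉ f.procs) ∧ ∀ r ∈ R, ∀ w ∈ W, f.Path r w

/-- `(F, R, W)` is a generalized quorum system, where `F` is a fail-prone system, `R` the family of
read quorums and `W` the family of write quorums. -/
structure IsGeneralizedQuorumSystem (F : Set (FailurePattern P)) (R W : Set (Set P)) : Prop where
  consistency : ∀ r ∈ R, ∀ w ∈ W, (r ∩ w).Nonempty
  availability : ∀ f ∈ F, ∃ w ∈ W, ∃ r ∈ R, f.Available w ∧ f.ReachableFrom w r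

/-- The union of the write quorums that validate availability with respect to `f`. -/
def availableUnion (R W : Set (Set P)) (f : FailurePattern P) : Set P :=
  {p | ∃ w ∈ W, f.Available w ∧ (∃ r ∈ R, f.ReachableFrom w r) ∧ p ∈ w}

/-- `U_f`: the strongly connected component of the residual graph that contains
`availableUnion R W f`. -/
def terminationComponent (R W : Set (Set P)) (f : FailurePattern P) : Set P :=
  {p | ∃ q ∈ availableUnion R W f, f.Path p q ∧ f.Path q p}

/-! ### Message-passing algorithms -/

/-- What a process reacts to in a step: nothing (a spontaneous internal step), the invocation
`propose(x)`, the expiry of its timer, or the receipt of message `m` from process `q`. -/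
inductive Input (P : Type u) (V : Type v) (M : Type (max u v)) : Type (max u v)
  | internal
  | invoke (x : V)
  | timeout
  | receive (q : P) (m : M)

/-- The outcome of a step: the new local state, the message (if any) sent to each process,
the duration in units of the local clock with which the timer is (re)started (if it is), and the
value (if any) returned to the caller of `propose`. -/
structure Outcome (P : Type u) (V : Type v) (S M : Type (max u v)) : Type (max u v) where
  state : S
  send : P → Option M
  timer : Option ℕ+
  response : Option V

/-- A deterministic message-passing algorithm for the processes `P` that provides one operation
`propose(x)`, `x : V`, with return values in `V`. Each process has a timer that is measured by
its local clock; it is not running initially. -/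
structure Algorithm (P : Type u) (V : Type v) where
  State : Type (max u v)
  Msg : Type (max u v)
  init : P → State
  step : P → State → Input P V Msg → Outcome P V State Msg

/-- Events of a run. `receive q p m i` is the receipt by `q` of the message `m` that `p` sent to `q`
in the event with index `i`; `disconnect p q` is the failure of the channel `(p, q)`; in `idle`
nothing happens. -/
inductive Event (P : Type u) (V : Type v) (M : Type (max u v)) : Type (max u v)
  | idle
  | crash (p : P)
  | disconnect (p q : P)
  | internal (p : P)
  | invoke (p : P) (x : V)
  | timeout (p : P)
  | receive (q p : P) (m : M) (i : ℕ)

/-- The process that takes a step in an event and what it reacts to, if the event is a step. -/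
def Event.action {M : Type (max u v)} : Event P V M → Option (P × Input P V M)
  | .idle => none
  | .crash _ => none
  | .disconnect _ _ => none
  | .internal p => some (p, .internal)
  | .invoke p x => some (p, .invoke x)
  | .timeout p => some (p, .timeout)
  | .receive q p m _ => some (q, .receive p m)

/-- A run: a sequence of events, the real times at which they occur, and for each process the
reading of its local clock as a function of real time. -/
structure Run (A : Algorithm P V) where
  event : ℕ → Event P V A.Msg
  time : ℕ → ℝ
  clock : P → ℝ → ℝ

/-- The local state of a process and the local clock reading at which its timer expires (`none` if
the timer is not running). -/
structure LocalConfig (A : Algorithm P V) where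
  state : A.State
  deadline : Option ℝ

namespace Run

variable {A : Algorithm P V}

/-- The configuration of a process after it reacted to an input when its clock read `now`. Starting
the timer replaces the previous deadline; an expired timer stops unless it is restarted. -/
def next (A : Algorithm P V) (p : P) (now : ℝ) (c : LocalConfig A) (inp : Input P V A.Msg) :
    LocalConfig A where
  state := (A.step p c.state inp).state
  deadline :=
    match (A.step p c.state inp).timer, inp with
    | some k, _ => some (now + ((k : ℕ) : ℝ))
    | none, .timeout => none
    | none, _ => c.deadline

open Classical in
/-- The configuration of each process just before the event with the given index. -/
noncomputable def config (σ : Run A) : ℕ → P → LocalConfig A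
  | 0, q => ⟨A.init q, none⟩
  | i + 1, q =>
    match (σ.event i).action with
    | none => config σ i q
    | some (p, inp) =>
      if q = p then next A p (σ.clock p (σ.time i)) (config σ i p) inp else config σ i q

/-- Process `p` takes a step in event `i`, with outcome `o`. -/
def Steps (σ : Run A) (i : ℕ) (p : P) (o : Outcome P V A.State A.Msg) : Prop :=
  ∃ inp, (σ.event i).action = some (p, inp) ∧ o = A.step p (σ.config i p).state inp

/-- Process `p` sends message `m` to `q` in event `i`. -/
def Sends (σ : Run A) (i : ℕ) (p q : P) (m : A.Msg) : Prop :=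
  ∃ o, σ.Steps i p o ∧ o.send q = some m

/-- Process `p` (re)starts its timer in event `i`. -/
def StartsTimer (σ : Run A) (i : ℕ) (p : P) : Prop :=
  ∃ o, σ.Steps i p o ∧ o.timer.isSome

/-- An operation invoked at `p` returns `x` in event `i`. -/
def Returns (σ : Run A) (i : ℕ) (p : P) (x : V) : Prop :=
  ∃ o, σ.Steps i p o ∧ o.response = some x

/-- Just before event `i`, an operation of `p` has been invoked and has not yet returned. -/
def Pending (σ : Run A) (i : ℕ) (p : P) : Prop :=
  ∃ j < i, (∃ x, σ.event j = .invoke p x) ∧ ∀ k, j ≤ k → k < i → ∀ y, ¬ σ.Returns k p y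

/-- `σ` is an execution of `A`, with arbitrary failures and arbitrary timing. Local steps take no
time. -/
structure IsExecution (σ : Run A) : Prop where
  time_mono : Monotone σ.time
  time_unbounded : Filter.Tendsto σ.time Filter.atTop Filter.atTop
  clock_mono : ∀ p, Monotone (σ.clock p)
  /-- a crashed process takes no more steps -/
  crash_stops : ∀ i j p, i < j → σ.event i = .crash p → ∀ o, ¬ σ.Steps j p o
  /-- a process invokes an operation only when it has no pending one -/
  invoke_sequential : ∀ i p x, σ.event i = .invoke p x → ¬ σ.Pending i p
  /-- a timer expires only if it is running and the local clock has reached its deadline -/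
  timeout_due : ∀ i p, σ.event i = .timeout p →
    ∃ d, (σ.config i p).deadline = some d ∧ d ≤ σ.clock p (σ.time i)
  /-- only messages sent before are received -/
  receive_sent : ∀ j q p m i, σ.event j = .receive q p m i → i < j ∧ σ.Sends i p q m
  /-- each message is received at most once -/
  receive_once : ∀ j j' q p m m' i, σ.event j = .receive q p m i →
    σ.event j' = .receive q p m' i → j = j'
  /-- a disconnected channel drops all messages sent through it from then on -/
  disconnect_drops : ∀ k i p q m j, k < i → σ.event k = .disconnect p q →
    σ.event j ≠ .receive q p m i

/-- `p` is correct in `σ`: it never crashes. -/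
def Correct (σ : Run A) (p : P) : Prop :=
  ∀ i, σ.event i ≠ .crash p

/-- The channel `(p, q)` is correct in `σ`: it never disconnects. -/
def ChannelCorrect (σ : Run A) (p q : P) : Prop :=
  ∀ i, σ.event i ≠ .disconnect p q

/-- Correct channels between correct processes deliver all messages. -/
def Reliable (σ : Run A) : Prop :=
  ∀ i p q m, σ.Correct p → σ.Correct q → σ.ChannelCorrect p q → σ.Sends i p q m →
    ∃ j, σ.event j = .receive q p m i

/-- Every correct process takes infinitely many steps. -/
def Fair (σ : Run A) : Prop :=
  ∀ p, σ.Correct p → ∀ n, ∃ i ≥ n, ∃ o, σ.Steps i p o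

/-- At most the processes and channels of `f` fail in `σ`, where the channels incident to the
processes of `f` are considered faulty by default. -/
def Compliant (σ : Run A) (f : FailurePattern P) : Prop :=
  (∀ p, ¬ σ.Correct p → p ∈ f.procs) ∧
    ∀ p q, ¬ σ.ChannelCorrect p q → (p, q) ∈ f.chans ∨ p ∈ f.procs ∨ q ∈ f.procs

/-- Synchrony from time `gst` on, with message delay bound `δ`. -/
structure SynchronousAfter (σ : Run A) (gst δ : ℝ) : Prop where
  /-- messages sent from `gst` on between correct processes on correct channels are received
  within `δ` -/
  timely : ∀ i p q m, σ.Correct p → σ.Correct q → σ.ChannelCorrect p q → σ.Sends i p q m →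
    gst ≤ σ.time i → ∃ j, σ.event j = .receive q p m i ∧ σ.time j ≤ σ.time i + δ
  /-- from `gst` on, clocks do not drift -/
  clock_rate : ∀ p t, gst ≤ t → σ.clock p t = σ.clock p gst + (t - gst)
  /-- from `gst` on, a running timer of a correct process expires (unless it is restarted before)
  as soon as the local clock has reached its deadline -/
  timer_prompt : ∀ i p d t, σ.Correct p → (σ.config i p).deadline = some d → gst ≤ t →
    (∀ j < i, σ.time j ≤ t) → d ≤ σ.clock p t →
    ∃ j ≥ i, σ.time j ≤ t ∧ (σ.event j = .timeout p ∨ σ.StartsTimer j p)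

/-- `σ` satisfies the assumptions of the partially synchronous model, with some global
stabilization time and some bound on message delays. -/
def PartiallySynchronous (σ : Run A) : Prop :=
  ∃ gst δ : ℝ, 0 < δ ∧ σ.SynchronousAfter gst δ

end Run

/-! ### Consensus -/

namespace Algorithm

/-- Safety of consensus, in all executions: a process returns a value only to an operation that has
been invoked and has not returned yet; all returned values are equal (Agreement); and each returned
value was passed to an invocation of `propose` (Validity). -/
structure ImplementsConsensus (A : Algorithm P V) : Prop where
  response_matches : ∀ σ : Run A, σ.IsExecution → ∀ i p x, σ.Returns i p x →
    σ.Pending i p ∨ ∃ y, σ.event i = .invoke p y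
  agreement : ∀ σ : Run A, σ.IsExecution → ∀ i j p q x y,
    σ.Returns i p x → σ.Returns j q y → x = y
  validity : ∀ σ : Run A, σ.IsExecution → ∀ i p x, σ.Returns i p x →
    ∃ j ≤ i, ∃ q, σ.event j = .invoke q x

/-- `A` is `(f, T)`-wait-free in the partially synchronous model: in every fair `f`-compliant
execution, each operation invoked by a process of `T` returns. -/
def WaitFree (A : Algorithm P V) (f : FailurePattern P) (T : Set P) : Prop :=
  ∀ σ : Run A, σ.IsExecution → σ.Reliable → σ.PartiallySynchronous → σ.Fair → σ.Compliant f →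
    ∀ p ∈ T, ∀ i x, σ.event i = .invoke p x → ∃ j ≥ i, ∃ y, σ.Returns j p y

/-- `A` is `(F, τ)`-wait-free. -/
def SystemWaitFree (A : Algorithm P V) (F : Set (FailurePattern P)) (τ : F → Set P) : Prop :=
  ∀ f : F, A.WaitFree f (τ f)

end Algorithm

end GQS

namespace GQS

universe u v

/-! ### A view-based consensus algorithm -/

/-! The algorithm is a Paxos variant in which each process gossips its whole set of known facts
whenever that set grows. Processes pass through numbered views with rotating leaders. A leader
proposes once it knows that a read quorum has entered its view, taking over the latest lower
proposal it knows; processes vote for proposals of their current view, and a proposal decides when a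
write quorum has voted for it. Nothing is requested: entries are pushed to the leader, so paths from
the read quorum suffice and none back to it is needed.

Safety. As messages carry all knowledge, knowing that `p` entered view `n` entails knowing every
proposal for which `p` votes in lower views (`prop_mem_known_of_enter`). If a write quorum chose `y`
in view `m`, a later leader has heard from a read quorum that meets it, so it knows `y`'s proposal.
Its latest known proposal then has view at least `m`, and induction on views gives `y`
(`eq_of_chosen`).

Liveness. After stabilization view `n` lasts exactly `n` time units (`Enters.time_eq`), so the skew
between correct processes stays constant while views grow. Facts created after stabilization cross
residual paths within a fixed delay (`exists_delay`). Hence in a late enough view led by the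
invoking process itself, its proposal gathers a write quorum of votes. Quorum intersection supplies
the paths for all of `U_f` (`exists_quorums_of_terminationComponent`). -/

/-- What processes learn about an execution: that a process entered a view, that a value was
proposed by the leader of a view, and that a process voted for a value in a view. -/
inductive Info (P : Type u) (V : Type v) : Type (max u v)
  | enter (p : P) (n : ℕ)
  | prop (n : ℕ) (x : V)
  | vote (p : P) (n : ℕ) (x : V)

/-- The local state: the known facts, the current view, and the argument of the pending
operation. View `0` is the one before the first step. -/
structure PaxosState (P : Type u) (V : Type v) : Type (max u v) where
  known : Set (Info P V)
  view : ℕ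
  pending : Option V

namespace Paxos

open Info

variable {P : Type u} {V : Type v}

/-- The value `x` has been voted for by a write quorum in some view. -/
def Decided (W : Set (Set P)) (K : Set (Info P V)) (x : V) : Prop :=
  ∃ n, prop n x ∈ K ∧ ∃ w ∈ W, ∀ p ∈ w, vote p n x ∈ K

/-- `x` is proposed in the highest view below `n` in which a proposal is known. -/
def Latest (K : Set (Info P V)) (n : ℕ) (x : V) : Prop :=
  ∃ m < n, prop m x ∈ K ∧ ∀ m' y, m' < n → prop m' y ∈ K → m' ≤ m

open Classical in
/-- The value that the leader of view `n` proposes when its own input is `own`. -/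
noncomputable def estimate (K : Set (Info P V)) (n : ℕ) (own : V) : V :=
  if h : ∃ x, Latest K n x then h.choose else own

/-- The facts received with an input. -/
def received : Input P V (Set (Info P V)) → Set (Info P V)
  | .receive _ m => m
  | _ => ∅

/-- The view after reacting to an input. -/
def nextView (s : PaxosState P V) : Input P V (Set (Info P V)) → ℕ
  | .timeout => s.view + 1
  | _ => if s.view = 0 then 1 else s.view

/-- The argument of the operation that is pending while reacting to an input. -/
def pendingInput (s : PaxosState P V) : Input P V (Set (Info P V)) → Option V
  | .invoke x => some x
  | _ => s.pending

/-- The known facts after receiving a message and entering the next view. -/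
def entered (p : P) (s : PaxosState P V) (inp : Input P V (Set (Info P V))) : Set (Info P V) :=
  insert (enter p (nextView s inp)) (s.known ∪ received inp)

/-- The known facts after the leader has made its proposal, which requires that a read quorum
has entered the view. -/
def proposed (R : Set (Set P)) (Lead : P → ℕ → Prop) (p : P) (n : ℕ) (own : Option V)
    (K : Set (Info P V)) : Set (Info P V) :=
  K ∪ {a | Lead p n ∧ (∀ y, prop n y ∉ K) ∧ (∃ r ∈ R, ∀ q ∈ r, enter q n ∈ K) ∧
    ∃ x, own = some x ∧ a = prop n (estimate K n x)}

/-- The known facts after voting for the proposals of the current view. -/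
def voted (p : P) (n : ℕ) (K : Set (Info P V)) : Set (Info P V) :=
  K ∪ {a | ∃ x, prop n x ∈ K ∧ a = vote p n x}

/-- The known facts after reacting to an input. -/
def nextKnown (R : Set (Set P)) (Lead : P → ℕ → Prop) (p : P) (s : PaxosState P V)
    (inp : Input P V (Set (Info P V))) : Set (Info P V) :=
  voted p (nextView s inp)
    (proposed R Lead p (nextView s inp) (pendingInput s inp) (entered p s inp))

open Classical in
/-- A decided value, if there is one. -/
noncomputable def decision (W : Set (Set P)) (K : Set (Info P V)) : Option V :=
  if h : ∃ x, Decided W K x then some h.choose else none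

/-- The value returned while reacting to an input. -/
noncomputable def response (R W : Set (Set P)) (Lead : P → ℕ → Prop) (p : P)
    (s : PaxosState P V) (inp : Input P V (Set (Info P V))) : Option V :=
  (pendingInput s inp).bind fun _ => decision W (nextKnown R Lead p s inp)

open Classical in
/-- The algorithm: processes move through the views, view `n` lasting `n` units of the local
clock, and send all they know to everyone whenever they learn something. -/
noncomputable def algorithm (R W : Set (Set P)) (Lead : P → ℕ → Prop) : Algorithm P V where
  State := PaxosState P V
  Msg := Set (Info P V)
  init _ := ⟨∅, 0, none⟩
  step p s inp :=
    { state :=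
        { known := nextKnown R Lead p s inp
          view := nextView s inp
          pending := if (response R W Lead p s inp).isSome then none else pendingInput s inp }
      send := fun _ => if nextKnown R Lead p s inp = s.known then none
        else some (nextKnown R Lead p s inp)
      -- A view changes only by one, so this duration `s.view + 1` is the number of the view being
      -- entered.
      timer := if nextView s inp = s.view then none else some s.view.succPNat
      response := response R W Lead p s inp }

/-! ### Effect of a single step -/

section Step

variable {R W : Set (Set P)} {Lead : P → ℕ → Prop} {p : P} {s : PaxosState P V}
  {inp : Input P V (Set (Info P V))} {K : Set (Info P V)} {n : ℕ}

theorem latest_estimate_or (K : Set (Info P V)) (n : ℕ) (own : V) :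
    Latest K n (estimate K n own) ∨
      ((∀ m y, m < n → prop m y ∉ K) ∧ estimate K n own = own) := by
  classical
  by_cases h : ∃ x, Latest K n x
  · left
    rw [estimate, dif_pos h]
    exact h.choose_spec
  · right
    refine ⟨fun m y hm hy => h ?_, by rw [estimate, dif_neg h]⟩
    -- The views below `n` with a known proposal are bounded, so the greatest one witnesses
    -- `Latest`.
    let Q : ℕ → Prop := fun k => k < n ∧ ∃ z, prop k z ∈ K
    have hQ : Q m := ⟨hm, y, hy⟩
    obtain ⟨hk, z, hz⟩ : Q (Nat.findGreatest Q n) := Nat.findGreatest_spec hm.le hQ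
    exact ⟨z, _, hk, hz, fun m' y' hm' hy' => Nat.le_findGreatest hm'.le ⟨hm', y', hy'⟩⟩

theorem decision_eq_some {x : V} (h : decision W K = some x) : Decided W K x := by
  classical
  unfold decision at h
  split_ifs at h with h'
  obtain rfl := Option.some.inj h
  exact h'.choose_spec

theorem decision_isSome {x : V} (h : Decided W K x) : (decision W K).isSome := by
  classical
  rw [decision, dif_pos ⟨x, h⟩]
  rfl

theorem view_le_nextView : s.view ≤ nextView s inp := by
  cases inp <;> simp only [nextView] <;> (try split_ifs) <;> omega

theorem nextView_le : nextView s inp ≤ s.view + 1 := by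
  cases inp <;> simp only [nextView] <;> (try split_ifs) <;> omega

theorem nextView_pos : 0 < nextView s inp := by
  cases inp <;> simp only [nextView] <;> (try split_ifs) <;> omega

theorem eq_timeout_of_nextView_ne (h : nextView s inp ≠ s.view) (h0 : s.view ≠ 0) :
    inp = .timeout := by
  cases inp <;> simp_all [nextView]

theorem subset_entered : s.known ∪ received inp ⊆ entered p s inp :=
  Set.subset_insert _ _

theorem entered_subset_nextKnown : entered p s inp ⊆ nextKnown R Lead p s inp :=
  fun _ h => Or.inl (Or.inl h)

theorem subset_nextKnown : s.known ∪ received inp ⊆ nextKnown R Lead p s inp :=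
  subset_entered.trans entered_subset_nextKnown

theorem enter_mem_nextKnown : enter p (nextView s inp) ∈ nextKnown R Lead p s inp :=
  entered_subset_nextKnown (Set.mem_insert _ _)

theorem enter_mem_nextKnown_iff {q : P} :
    enter q n ∈ nextKnown R Lead p s inp ↔ enter q n ∈ entered p s inp := by
  simp [nextKnown, voted, proposed]

theorem prop_mem_nextKnown_iff {x : V} : prop n x ∈ nextKnown R Lead p s inp ↔
    prop n x ∈ proposed R Lead p (nextView s inp) (pendingInput s inp) (entered p s inp) := by
  simp [nextKnown, voted]

theorem prop_mem_entered_of_ne {x : V} (h : prop n x ∈ nextKnown R Lead p s inp)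
    (hn : n ≠ nextView s inp) : prop n x ∈ entered p s inp := by
  rw [prop_mem_nextKnown_iff] at h
  obtain h | ⟨-, -, -, y, -, h⟩ := h
  · exact h
  · cases h
    exact absurd rfl hn

theorem eq_of_enter_created {q : P} (h : enter q n ∈ nextKnown R Lead p s inp)
    (h' : enter q n ∉ s.known ∪ received inp) : q = p ∧ n = nextView s inp := by
  rw [enter_mem_nextKnown_iff] at h
  obtain h | h := h
  · cases h
    exact ⟨rfl, rfl⟩
  · exact absurd h h'

theorem of_prop_created {x : V} (h : prop n x ∈ nextKnown R Lead p s inp)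
    (h' : prop n x ∉ s.known ∪ received inp) :
    n = nextView s inp ∧ Lead p n ∧ (∀ y, prop n y ∉ s.known) ∧
      (∃ r ∈ R, ∀ q ∈ r, enter q n ∈ entered p s inp) ∧
      ∃ own, pendingInput s inp = some own ∧ x = estimate (entered p s inp) n own := by
  rw [prop_mem_nextKnown_iff] at h
  obtain (h | h) | ⟨h1, h2, h3, y, h4, h⟩ := h
  · cases h
  · exact absurd h h'
  · cases h
    exact ⟨rfl, h1, fun y hy => h2 y (subset_entered (Or.inl hy)), h3, y, h4, rfl⟩

theorem of_vote_created {q : P} {x : V} (h : vote q n x ∈ nextKnown R Lead p s inp)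
    (h' : vote q n x ∉ s.known ∪ received inp) :
    q = p ∧ n = nextView s inp ∧ prop n x ∈ nextKnown R Lead p s inp := by
  obtain ((h | h) | ⟨-, -, -, y, -, h⟩) | ⟨y, hy, h⟩ := h
  · cases h
  · exact absurd h h'
  · cases h
  · cases h
    exact ⟨rfl, rfl, Or.inl hy⟩

theorem exists_prop_mem_nextKnown (hl : Lead p (nextView s inp))
    (hp : (pendingInput s inp).isSome)
    (hr : ∃ r ∈ R, ∀ q ∈ r, enter q (nextView s inp) ∈ nextKnown R Lead p s inp) :
    ∃ x, prop (nextView s inp) x ∈ nextKnown R Lead p s inp := by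
  obtain ⟨own, hown⟩ := Option.isSome_iff_exists.1 hp
  by_cases h : ∀ y, prop (nextView s inp) y ∉ entered p s inp
  · obtain ⟨r, hr, hr'⟩ := hr
    exact ⟨_, Or.inl (Or.inr ⟨hl, h, ⟨r, hr, fun q hq => enter_mem_nextKnown_iff.1 (hr' q hq)⟩,
      own, hown, rfl⟩)⟩
  · push Not at h
    obtain ⟨y, hy⟩ := h
    exact ⟨y, entered_subset_nextKnown hy⟩

theorem vote_mem_nextKnown {x : V} (h : prop (nextView s inp) x ∈ nextKnown R Lead p s inp) :
    vote p (nextView s inp) x ∈ nextKnown R Lead p s inp :=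
  Or.inr ⟨x, prop_mem_nextKnown_iff.1 h, rfl⟩

end Step

/-! ### Executions and the origin of facts -/

section Run

variable {R W : Set (Set P)} {Lead : P → ℕ → Prop} {σ : Run (algorithm R W Lead : Algorithm P V)}

/-- The facts known to `q` just before event `i`. -/
noncomputable def known (σ : Run (algorithm R W Lead : Algorithm P V)) (i : ℕ) (q : P) : Set (Info P V) :=
  PaxosState.known (σ.config i q).state

/-- The view of `q` just before event `i`. -/
noncomputable def view (σ : Run (algorithm R W Lead : Algorithm P V)) (i : ℕ) (q : P) : ℕ :=
  PaxosState.view (σ.config i q).state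

/-- The argument of the pending operation of `q` just before event `i`. -/
noncomputable def pending (σ : Run (algorithm R W Lead : Algorithm P V)) (i : ℕ) (q : P) : Option V :=
  PaxosState.pending (σ.config i q).state

theorem config_succ_of_action {i : ℕ} {q : P} {inp : Input P V (Set (Info P V))}
    (h : (σ.event i).action = some (q, inp)) :
    σ.config (i + 1) q =
      Run.next (algorithm R W Lead) q (σ.clock q (σ.time i)) (σ.config i q) inp := by
  simp only [Run.config]
  rw [h]
  simp

/-- Either `q` does not step in event `i`, or its configuration is the one after a step. -/
theorem config_succ (σ : Run (algorithm R W Lead : Algorithm P V)) (i : ℕ) (q : P) :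
    σ.config (i + 1) q = σ.config i q ∨
      ∃ inp, (σ.event i).action = some (q, inp) := by
  rcases h : (σ.event i).action with _ | ⟨p, inp⟩
  · left
    simp only [Run.config]
    rw [h]
  · by_cases hq : q = p
    · subst hq
      exact Or.inr ⟨inp, rfl⟩
    · left
      simp only [Run.config]
      rw [h]
      simp [hq]

section StepOfRun

variable {i : ℕ} {q : P} {inp : Input P V (Set (Info P V))}

theorem known_succ (h : (σ.event i).action = some (q, inp)) :
    known σ (i + 1) q = nextKnown R Lead q (σ.config i q).state inp := by
  rw [known, config_succ_of_action h]
  rfl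

theorem view_succ (h : (σ.event i).action = some (q, inp)) :
    view σ (i + 1) q = nextView (σ.config i q).state inp := by
  rw [view, config_succ_of_action h]
  rfl

open Classical in
theorem pending_succ (h : (σ.event i).action = some (q, inp)) :
    pending σ (i + 1) q = if (response R W Lead q (σ.config i q).state inp).isSome then none
      else pendingInput (σ.config i q).state inp := by
  rw [pending, config_succ_of_action h]
  rfl

theorem exists_of_returns {x : V} (h : σ.Returns i q x) :
    ∃ inp, (σ.event i).action = some (q, inp) ∧
      response R W Lead q (σ.config i q).state inp = some x := by
  obtain ⟨o, ⟨inp, h1, rfl⟩, h2⟩ := h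
  exact ⟨inp, h1, h2⟩

end StepOfRun

theorem known_subset_succ (i : ℕ) (q : P) : known σ i q ⊆ known σ (i + 1) q := by
  obtain h | ⟨inp, h⟩ := config_succ σ i q
  · rw [known, known, h]
  · rw [known_succ h]
    exact Set.subset_union_left.trans subset_nextKnown

theorem known_mono (q : P) : Monotone fun i => known σ i q :=
  monotone_nat_of_le_succ fun i => known_subset_succ i q

theorem view_mono (q : P) : Monotone fun i => view σ i q := by
  refine monotone_nat_of_le_succ fun i => ?_
  obtain h | ⟨inp, h⟩ := config_succ σ i q
  · simp only [view, h, le_refl]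
  · rw [view_succ h]
    exact view_le_nextView

theorem eq_known_of_sends {i : ℕ} {p q : P} {m : Set (Info P V)} (h : σ.Sends i p q m) :
    m = known σ (i + 1) p := by
  classical
  obtain ⟨o, ⟨inp, h1, rfl⟩, h2⟩ := h
  rw [known_succ h1]
  change (if nextKnown R Lead p (σ.config i p).state inp =
    PaxosState.known (σ.config i p).state then none
    else some (nextKnown R Lead p (σ.config i p).state inp)) = some m at h2
  split_ifs at h2
  exact (Option.some.inj h2).symm

theorem sends_of_known_ne {i : ℕ} {p : P} (h : known σ (i + 1) p ≠ known σ i p) (q : P) :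
    σ.Sends i p q (known σ (i + 1) p) := by
  classical
  obtain h' | ⟨inp, h'⟩ := config_succ σ i p
  · exact absurd (by rw [known, known, h']) h
  · refine ⟨_, ⟨inp, h', rfl⟩, ?_⟩
    rw [known_succ h'] at h ⊢
    change (if nextKnown R Lead p (σ.config i p).state inp =
      PaxosState.known (σ.config i p).state then none
      else some (nextKnown R Lead p (σ.config i p).state inp)) = _
    exact if_neg h

theorem exists_of_mem_received (hσ : σ.IsExecution) {i : ℕ} {q : P}
    {inp : Input P V (Set (Info P V))} (h : (σ.event i).action = some (q, inp)) {a : Info P V}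
    (ha : a ∈ received inp) :
    ∃ j < i, ∃ p, a ∈ known σ (j + 1) p ∧ received inp = known σ (j + 1) p := by
  rcases he : σ.event i with _ | _ | _ | _ | _ | _ | ⟨q', p, m, j⟩ <;>
    simp only [he, Event.action] at h <;> cases h <;> try exact absurd ha (Set.notMem_empty a)
  obtain ⟨hj, hs⟩ := hσ.receive_sent i q p m j he
  have hm := eq_known_of_sends hs
  exact ⟨j, hj, p, hm ▸ ha, hm⟩

/-- In event `i`, process `p` adds `a` to the known facts, without having received it. -/
def Creates (σ : Run (algorithm R W Lead : Algorithm P V)) (i : ℕ) (p : P) (a : Info P V) : Prop :=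
  ∃ inp, (σ.event i).action = some (p, inp) ∧
    a ∈ nextKnown R Lead p (σ.config i p).state inp ∧ a ∉ known σ i p ∪ received inp

/-- In the case of a receipt the whole knowledge of the sender is inherited, not just `a`; the
safety argument rests on this. -/
theorem mem_known_succ_cases (hσ : σ.IsExecution) {i : ℕ} {q : P} {a : Info P V}
    (ha : a ∈ known σ (i + 1) q) :
    a ∈ known σ i q ∨
      (∃ j < i, ∃ p, a ∈ known σ (j + 1) p ∧ known σ (j + 1) p ⊆ known σ (i + 1) q) ∨
      Creates σ i q a := by
  obtain h | ⟨inp, h⟩ := config_succ σ i q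
  · left
    rwa [known, h] at ha
  · by_cases h1 : a ∈ known σ i q
    · exact Or.inl h1
    by_cases h2 : a ∈ received inp
    · obtain ⟨j, hj, p, hp, he⟩ := exists_of_mem_received hσ h h2
      refine Or.inr (Or.inl ⟨j, hj, p, hp, ?_⟩)
      rw [← he, known_succ h]
      exact Set.subset_union_right.trans subset_nextKnown
    · refine Or.inr (Or.inr ⟨inp, h, known_succ h ▸ ha, fun h' => h'.elim h1 h2⟩)

/-- A receipt points to an earlier send, so tracing a fact back through messages must end at a
process that produced it. -/
theorem exists_creates (hσ : σ.IsExecution) {i : ℕ} {q : P} {a : Info P V}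
    (ha : a ∈ known σ i q) : ∃ j < i, ∃ p, Creates σ j p a := by
  induction i using Nat.strong_induction_on generalizing q with
  | _ i ih =>
    obtain _ | i := i
    · exact absurd ha (Set.notMem_empty a)
    · obtain h | ⟨j, hj, p, hp, -⟩ | h := mem_known_succ_cases hσ ha
      · obtain ⟨j, hj, h⟩ := ih i (by omega) h
        exact ⟨j, by omega, h⟩
      · obtain ⟨k, hk, h⟩ := ih (j + 1) (by omega) hp
        exact ⟨k, by omega, h⟩
      · exact ⟨i, by omega, q, h⟩

theorem Creates.mem_known {i : ℕ} {p : P} {a : Info P V} (h : Creates σ i p a) :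
    a ∈ known σ (i + 1) p := by
  obtain ⟨inp, h1, h2, -⟩ := h
  rwa [known_succ h1]

theorem Creates.enter {i n : ℕ} {p q : P} (h : Creates σ i p (enter q n)) :
    q = p ∧ view σ (i + 1) p = n := by
  obtain ⟨inp, h1, h2, h3⟩ := h
  rw [view_succ h1]
  obtain ⟨h4, h5⟩ := eq_of_enter_created h2 h3
  exact ⟨h4, h5.symm⟩

theorem Creates.vote {i n : ℕ} {p q : P} {x : V} (h : Creates σ i p (vote q n x)) :
    q = p ∧ view σ (i + 1) p = n ∧ prop n x ∈ known σ (i + 1) p := by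
  obtain ⟨inp, h1, h2, h3⟩ := h
  rw [view_succ h1, known_succ h1]
  obtain ⟨h4, h5, h6⟩ := of_vote_created h2 h3
  exact ⟨h4, h5.symm, h6⟩

theorem Creates.prop {i n : ℕ} {p : P} {x : V} (h : Creates σ i p (prop n x)) :
    view σ (i + 1) p = n ∧ Lead p n ∧ ∀ y, Info.prop n y ∉ known σ i p := by
  obtain ⟨inp, h1, h2, h3⟩ := h
  rw [view_succ h1]
  obtain ⟨h4, h5, h6, -⟩ := of_prop_created h2 h3
  exact ⟨h4.symm, h5, h6⟩

/-! ### Safety -/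

/-- Only the leader of a view creates its proposals, and only while it knows of none. Since it never
forgets, both creations are the same event, where the value is determined by state and input. -/
theorem prop_unique (hL : ∀ p q n, Lead p n → Lead q n → p = q) (hσ : σ.IsExecution)
    {i i' n : ℕ} {q q' : P} {x y : V} (hx : prop n x ∈ known σ i q)
    (hy : prop n y ∈ known σ i' q') : x = y := by
  obtain ⟨j, -, p, hj⟩ := exists_creates hσ hx
  obtain ⟨j', -, p', hj'⟩ := exists_creates hσ hy
  obtain ⟨-, hl, hn⟩ := hj.prop
  obtain ⟨-, hl', hn'⟩ := hj'.prop
  obtain rfl := hL _ _ _ hl hl'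
  rcases lt_trichotomy j j' with h | rfl | h
  · exact absurd (known_mono p (show j + 1 ≤ j' from h) hj.mem_known) (hn' x)
  · obtain ⟨inp, h1, h2, h3⟩ := hj
    obtain ⟨inp', h1', h2', h3'⟩ := hj'
    obtain rfl : inp = inp' := by
      rw [h1] at h1'
      cases h1'
      rfl
    obtain ⟨-, -, -, -, own, ho, rfl⟩ := of_prop_created h2 h3
    obtain ⟨-, -, -, -, own', ho', rfl⟩ := of_prop_created h2' h3'
    rw [ho] at ho'
    cases ho'
    rfl
  · exact absurd (known_mono p (show j' + 1 ≤ j from h) hj'.mem_known) (hn y)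

/-- Who knows that `p` entered a view knows the proposals for which `p` ever votes in lower
views. -/
theorem prop_mem_known_of_enter (hσ : σ.IsExecution) {i j m n : ℕ} {p q q' : P} {x : V}
    (hv : vote p m x ∈ known σ j q') (hmn : m < n) (he : enter p n ∈ known σ i q) :
    prop m x ∈ known σ i q := by
  obtain ⟨k, -, p', hk⟩ := exists_creates hσ hv
  obtain ⟨rfl, hkv, hkp⟩ := hk.vote
  induction i using Nat.strong_induction_on generalizing q with
  | _ i ih =>
    obtain _ | i := i
    · exact absurd he (Set.notMem_empty _)
    · obtain h | ⟨l, hl, p', hp', hsub⟩ | h := mem_known_succ_cases hσ he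
      · exact known_subset_succ i q (ih i (by omega) h)
      · exact hsub (ih (l + 1) (by omega) hp')
      · obtain ⟨rfl, hv⟩ := h.enter
        -- The vote is created in view `m < n`, so by monotonicity of views it cannot come after the
        -- entry into `n`.
        refine known_mono p (?_ : k + 1 ≤ i + 1) hkp
        by_contra! hlt
        have := view_mono (σ := σ) p hlt.le
        simp only at this
        omega

/-- A proposal agrees with all values chosen in lower views. -/
theorem eq_of_chosen (hRW : ∀ r ∈ R, ∀ w ∈ W, (r ∩ w).Nonempty)
    (hL : ∀ p q n, Lead p n → Lead q n → p = q) (hσ : σ.IsExecution) {m : ℕ} {y : V} {j : ℕ}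
    {q' : P} {w : Set P} (hw : w ∈ W) (hv : ∀ p ∈ w, vote p m y ∈ known σ j q')
    {n i : ℕ} {q : P} {x : V} (hx : prop n x ∈ known σ i q) (hmn : m < n) : x = y := by
  induction n using Nat.strong_induction_on generalizing i q x with
  | _ n ih =>
    obtain ⟨k, -, l, inp, h1, h2, h3⟩ := exists_creates hσ hx
    obtain ⟨hn, -, -, ⟨r, hr, hr'⟩, own, -, rfl⟩ := of_prop_created h2 h3
    obtain ⟨p, hpr, hpw⟩ := hRW r hr w hw
    have hK : nextKnown R Lead l (σ.config k l).state inp = known σ (k + 1) l := (known_succ h1).symm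
    -- The process `p` common to both quorums voted for `y` and is known to have entered `n`. The
    -- estimate is computed from `entered`, before the new proposal is added; as `m ≠ n`, nothing is
    -- lost in going back to it.
    have hy : prop m y ∈ entered l (σ.config k l).state inp := by
      refine prop_mem_entered_of_ne (R := R) (Lead := Lead) ?_ (by omega)
      rw [hK]
      refine prop_mem_known_of_enter hσ (hv p hpw) hmn ?_
      rw [← hK]
      exact entered_subset_nextKnown (hr' p hpr)
    obtain ⟨m', hm', hx', hmax⟩ | ⟨hno, -⟩ :=
      latest_estimate_or (entered l (σ.config k l).state inp) n own
    · have hx'' := entered_subset_nextKnown (R := R) (Lead := Lead) hx'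
      have hy'' := entered_subset_nextKnown (R := R) (Lead := Lead) hy
      rw [hK] at hx'' hy''
      obtain h | h := (hmax m y hmn hy).eq_or_lt
      · subst h
        exact prop_unique hL hσ hx'' hy''
      · exact ih m' hm' hx'' h
    · exact absurd hy (hno m y hmn)

theorem decided_unique (hRW : ∀ r ∈ R, ∀ w ∈ W, (r ∩ w).Nonempty)
    (hL : ∀ p q n, Lead p n → Lead q n → p = q) (hσ : σ.IsExecution) {i j : ℕ} {p q : P} {x y : V}
    (hx : Decided W (known σ i p) x) (hy : Decided W (known σ j q) y) : x = y := by
  obtain ⟨n, hn, w, hw, hwv⟩ := hx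
  obtain ⟨m, hm, w', hw', hwv'⟩ := hy
  rcases lt_trichotomy m n with h | rfl | h
  · exact eq_of_chosen hRW hL hσ hw' hwv' hn h
  · exact prop_unique hL hσ hn hm
  · exact (eq_of_chosen hRW hL hσ hw hwv hm h).symm

theorem decided_of_returns {i : ℕ} {p : P} {x : V} (h : σ.Returns i p x) :
    Decided W (known σ (i + 1) p) x := by
  obtain ⟨inp, h1, h2⟩ := exists_of_returns h
  rw [known_succ h1]
  obtain ⟨_, -, h3⟩ := Option.bind_eq_some_iff.1 h2
  exact decision_eq_some h3

theorem event_eq_invoke {i : ℕ} {p : P} {x : V}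
    (h : (σ.event i).action = some (p, Input.invoke x)) : σ.event i = .invoke p x := by
  rcases he : σ.event i with _ | _ | _ | _ | _ | _ | _ <;> simp only [he, Event.action] at h <;>
    cases h
  rfl

theorem event_eq_timeout {i : ℕ} {p : P}
    (h : (σ.event i).action = some (p, Input.timeout)) : σ.event i = .timeout p := by
  rcases he : σ.event i with _ | _ | _ | _ | _ | _ | _ <;> simp only [he, Event.action] at h <;>
    cases h
  rfl

theorem pendingInput_cases {s : PaxosState P V} {inp : Input P V (Set (Info P V))} {x : V}
    (h : pendingInput s inp = some x) : inp = .invoke x ∨ s.pending = some x := by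
  cases inp <;> simp_all [pendingInput]

/-- The stored argument is cleared in the very step that returns, so as long as it is present no
return has followed the invocation. -/
theorem pending_of_pending_eq_some {i : ℕ} {p : P} {x : V} (h : pending σ i p = some x) :
    σ.Pending i p ∧ ∃ j < i, σ.event j = .invoke p x := by
  classical
  induction i with
  | zero => exact absurd h (by simp [pending, Run.config, algorithm])
  | succ i ih =>
    have key : pending σ i p = some x → (∀ y, ¬ σ.Returns i p y) →
        σ.Pending (i + 1) p ∧ ∃ j < i + 1, σ.event j = .invoke p x := by
      intro hp hno
      obtain ⟨⟨j, hj, hinv, hr⟩, k, hk, hkx⟩ := ih hp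
      refine ⟨⟨j, by omega, hinv, fun l hjl hl => ?_⟩, k, by omega, hkx⟩
      obtain h | h := (Nat.lt_succ_iff.1 hl).eq_or_lt
      · exact h ▸ hno
      · exact hr l hjl h
    obtain h' | ⟨inp, h'⟩ := config_succ σ i p
    · rw [pending, h'] at h
      by_cases hno : ∀ y, ¬ σ.Returns i p y
      · exact key h hno
      · push Not at hno
        obtain ⟨y, hy⟩ := hno
        obtain ⟨inp, h1, h2⟩ := exists_of_returns hy
        have h3 := pending_succ h1
        rw [h2] at h3
        rw [pending, h', h] at h3
        simp at h3
    · rw [pending_succ h'] at h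
      split_ifs at h with hresp
      have hno : ∀ y, ¬ σ.Returns i p y := by
        intro y hy
        obtain ⟨inp', h1, h2⟩ := exists_of_returns hy
        rw [h'] at h1
        cases h1
        rw [h2] at hresp
        exact hresp rfl
      obtain rfl | h := pendingInput_cases h
      · have he := event_eq_invoke h'
        refine ⟨⟨i, by omega, ⟨x, he⟩, fun l h1 h2 => ?_⟩, i, by omega, he⟩
        obtain rfl : l = i := by omega
        exact hno
      · exact key h hno

/-- A proposal copies one from a lower view or uses the leader's own input; induction on the view
ends at an input. -/
theorem exists_invoke_of_prop (hσ : σ.IsExecution) {n i : ℕ} {q : P} {x : V}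
    (hx : prop n x ∈ known σ i q) : ∃ j < i, ∃ p, σ.event j = .invoke p x := by
  induction n using Nat.strong_induction_on generalizing i q x with
  | _ n ih =>
    obtain ⟨k, hk, l, inp, h1, h2, h3⟩ := exists_creates hσ hx
    obtain ⟨hn, -, -, -, own, ho, rfl⟩ := of_prop_created h2 h3
    obtain ⟨m', hm', hx', -⟩ | ⟨-, he⟩ :=
      latest_estimate_or (entered l (σ.config k l).state inp) n own
    · have hx'' := entered_subset_nextKnown (R := R) (Lead := Lead) hx'
      rw [← known_succ h1] at hx''
      obtain ⟨j, hj, h⟩ := ih m' hm' hx''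
      exact ⟨j, by omega, h⟩
    · rw [he]
      obtain rfl | h := pendingInput_cases ho
      · exact ⟨k, hk, l, event_eq_invoke h1⟩
      · obtain ⟨j, hj, h⟩ := (pending_of_pending_eq_some (σ := σ) h).2
        exact ⟨j, by omega, l, h⟩

theorem algorithm_implementsConsensus (hRW : ∀ r ∈ R, ∀ w ∈ W, (r ∩ w).Nonempty)
    (hL : ∀ p q n, Lead p n → Lead q n → p = q) :
    (algorithm R W Lead : Algorithm P V).ImplementsConsensus where
  response_matches σ _ i p x h := by
    obtain ⟨inp, h1, h2⟩ := exists_of_returns h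
    obtain ⟨y, h3, -⟩ := Option.bind_eq_some_iff.1 h2
    obtain rfl | h := pendingInput_cases h3
    · exact Or.inr ⟨y, event_eq_invoke h1⟩
    · exact Or.inl (pending_of_pending_eq_some (σ := σ) h).1
  agreement σ hσ i j p q x y hx hy :=
    decided_unique hRW hL hσ (decided_of_returns hx) (decided_of_returns hy)
  validity σ hσ i p x h := by
    obtain ⟨n, hn, -⟩ := decided_of_returns h
    obtain ⟨j, hj, h⟩ := exists_invoke_of_prop hσ hn
    exact ⟨j, by omega, h⟩

/-! ### Invariants of the local states -/

/-- Every step applies the proposal rule to all that it has learned, so the rule is never left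
applicable between steps. Initially nothing is known, which is where nonempty read quorums are
needed. -/
theorem exists_prop_of_lead (hR : ∀ r ∈ R, r.Nonempty) {i : ℕ} {q : P}
    (hl : Lead q (view σ i q)) (hp : (pending σ i q).isSome)
    (hr : ∃ r ∈ R, ∀ p ∈ r, enter p (view σ i q) ∈ known σ i q) :
    ∃ x, prop (view σ i q) x ∈ known σ i q := by
  classical
  induction i with
  | zero =>
    obtain ⟨r, hr, h⟩ := hr
    obtain ⟨p, hp⟩ := hR r hr
    exact absurd (h p hp) (Set.notMem_empty _)
  | succ i ih =>
    obtain h | ⟨inp, h⟩ := config_succ σ i q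
    · simp only [known, view, pending, h] at hl hp hr ⊢
      exact ih hl hp hr
    · rw [known_succ h, view_succ h] at *
      refine exists_prop_mem_nextKnown hl ?_ hr
      rw [pending_succ h] at hp
      split_ifs at hp
      · exact absurd hp (by simp)
      · exact hp

theorem vote_mem_known_of_prop {i : ℕ} {q : P} {x : V} (hx : prop (view σ i q) x ∈ known σ i q) :
    vote q (view σ i q) x ∈ known σ i q := by
  induction i with
  | zero => exact absurd hx (Set.notMem_empty _)
  | succ i ih =>
    obtain h | ⟨inp, h⟩ := config_succ σ i q
    · simp only [known, view, h] at hx ⊢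
      exact ih hx
    · rw [known_succ h, view_succ h] at *
      exact vote_mem_nextKnown hx

theorem not_decided_of_pending {i : ℕ} {q : P} (hp : (pending σ i q).isSome) (x : V) :
    ¬ Decided W (known σ i q) x := by
  classical
  induction i with
  | zero => exact absurd hp (by simp [pending, Run.config, algorithm])
  | succ i ih =>
    obtain h | ⟨inp, h⟩ := config_succ σ i q
    · simp only [known, pending, h] at hp ⊢
      exact ih hp
    · rw [known_succ h]
      rw [pending_succ h] at hp
      split_ifs at hp with hresp
      · exact absurd hp (by simp)
      · intro hd
        obtain ⟨y, hy⟩ := Option.isSome_iff_exists.1 hp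
        refine hresp ?_
        change ((pendingInput _ inp).bind _).isSome
        rw [hy]
        exact decision_isSome hd

theorem enter_mem_known {i : ℕ} {q : P} (h0 : view σ i q ≠ 0) :
    enter q (view σ i q) ∈ known σ i q := by
  induction i with
  | zero => exact absurd rfl h0
  | succ i ih =>
    obtain h | ⟨inp, h⟩ := config_succ σ i q
    · simp only [known, view, h] at h0 ⊢
      exact ih h0
    · rw [known_succ h, view_succ h]
      exact enter_mem_nextKnown

theorem pending_isSome_of_invoke {i : ℕ} {q : P} {x : V} (hi : σ.event i = .invoke q x)
    (hno : ∀ j ≥ i, ∀ y, ¬ σ.Returns j q y) {k : ℕ} (hk : i < k) : (pending σ k q).isSome := by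
  classical
  induction k, hk using Nat.le_induction with
  | base =>
    have h : (σ.event i).action = some (q, Input.invoke x) := by rw [hi]; rfl
    rw [pending_succ h, if_neg]
    · rfl
    · intro hs
      obtain ⟨y, hy⟩ := Option.isSome_iff_exists.1 hs
      exact hno i le_rfl y ⟨_, ⟨_, h, rfl⟩, hy⟩
  | succ k hk ih =>
    obtain h | ⟨inp, h⟩ := config_succ σ k q
    · rwa [pending, h]
    · rw [pending_succ h, if_neg]
      · cases inp
        · exact ih
        · rfl
        · exact ih
        · exact ih
      · intro hs
        obtain ⟨y, hy⟩ := Option.isSome_iff_exists.1 hs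
        exact hno k (by omega) y ⟨_, ⟨_, h, rfl⟩, hy⟩

/-- With the two lemmas that follow, this shows that facts of a view do not exist before the process
responsible for them enters it; hence they are fresh when that entry is after stabilization. -/
theorem le_view_of_enter (hσ : σ.IsExecution) {i n : ℕ} {p q : P}
    (h : enter p n ∈ known σ i q) : n ≤ view σ i p := by
  obtain ⟨j, hj, p', hc⟩ := exists_creates hσ h
  obtain ⟨rfl, rfl⟩ := hc.enter
  exact view_mono p (show j + 1 ≤ i from hj)

theorem le_view_of_vote (hσ : σ.IsExecution) {i n : ℕ} {p q : P} {x : V}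
    (h : vote p n x ∈ known σ i q) : n ≤ view σ i p := by
  obtain ⟨j, hj, p', hc⟩ := exists_creates hσ h
  obtain ⟨rfl, rfl, -⟩ := hc.vote
  exact view_mono p (show j + 1 ≤ i from hj)

theorem le_view_of_prop (hL : ∀ p q n, Lead p n → Lead q n → p = q) (hσ : σ.IsExecution)
    {i n : ℕ} {p q : P} {x : V} (hp : Lead p n) (h : prop n x ∈ known σ i q) :
    n ≤ view σ i p := by
  obtain ⟨j, hj, p', hc⟩ := exists_creates hσ h
  obtain ⟨rfl, hl, -⟩ := hc.prop
  obtain rfl := hL _ _ _ hp hl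
  exact view_mono p (show j + 1 ≤ i from hj)

/-! ### Views and timers -/

/-- Process `q` moves to view `n` in event `i`. -/
def Enters (σ : Run (algorithm R W Lead : Algorithm P V)) (i : ℕ) (q : P) (n : ℕ) : Prop :=
  view σ i q + 1 = n ∧ view σ (i + 1) q = n

theorem view_eq_of_config_eq {i j : ℕ} {q : P} (h : σ.config i q = σ.config j q) :
    view σ i q = view σ j q := by
  rw [view, view, h]

theorem view_succ_le (i : ℕ) (q : P) : view σ (i + 1) q ≤ view σ i q + 1 := by
  obtain h | ⟨inp, h⟩ := config_succ σ i q
  · simp only [view, h]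
    omega
  · rw [view_succ h]
    exact nextView_le

theorem Enters.lt_of_le_view {i k n : ℕ} {q : P} (h : Enters σ i q n) (hk : n ≤ view σ k q) :
    i < k := by
  by_contra! hlt
  have := view_mono (σ := σ) q hlt
  have := h.1
  simp only at *
  omega

theorem Enters.le_view {i k n : ℕ} {q : P} (h : Enters σ i q n) (hk : i < k) :
    n ≤ view σ k q :=
  h.2.symm.le.trans (view_mono q (show i + 1 ≤ k from hk))

theorem exists_enters {k n : ℕ} {q : P} (hn : 0 < n) (h : n ≤ view σ k q) :
    ∃ j < k, Enters σ j q n := by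
  induction k with
  | zero =>
    have : view σ 0 q = 0 := rfl
    omega
  | succ k ih =>
    by_cases hk : n ≤ view σ k q
    · obtain ⟨j, hj, h⟩ := ih hk
      exact ⟨j, by omega, h⟩
    · have := view_succ_le (σ := σ) k q
      exact ⟨k, by omega, by omega, by omega⟩

theorem view_eq_of_le {j n i i' : ℕ} {q : P} (h : Enters σ i q n) (h' : Enters σ i' q (n + 1))
    (h1 : i < j) (h2 : j ≤ i') : view σ j q = n := by
  have h3 := h.le_view h1
  have h4 := view_mono (σ := σ) q h2
  have := h'.1
  simp only at h4
  omega

/-- The timer is restarted only on a change of view, and an expiry, which would stop it, always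
changes the view. -/
theorem deadline_succ_of_eq {i : ℕ} {q : P} {inp : Input P V (Set (Info P V))}
    (h : (σ.event i).action = some (q, inp))
    (hv : nextView (σ.config i q).state inp = view σ i q) :
    (σ.config (i + 1) q).deadline = (σ.config i q).deadline := by
  rw [config_succ_of_action h]
  have ht : ((algorithm R W Lead : Algorithm P V).step q (σ.config i q).state inp).timer = none :=
    if_pos hv
  simp only [Run.next]
  rw [ht]
  cases inp <;> first | rfl | exact absurd hv (by simp [nextView, view])

theorem deadline_succ_of_ne {i : ℕ} {q : P} {inp : Input P V (Set (Info P V))}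
    (h : (σ.event i).action = some (q, inp))
    (hv : nextView (σ.config i q).state inp ≠ view σ i q) :
    (σ.config (i + 1) q).deadline = some (σ.clock q (σ.time i) + ((view σ i q + 1 : ℕ) : ℝ)) := by
  rw [config_succ_of_action h]
  have ht : ((algorithm R W Lead : Algorithm P V).step q (σ.config i q).state inp).timer =
    some (view σ i q).succPNat := if_neg hv
  simp only [Run.next]
  rw [ht]
  rfl

theorem Enters.deadline_eq {i j n : ℕ} {q : P} (h : Enters σ i q n) (hj : i < j)
    (hv : view σ j q = n) : (σ.config j q).deadline = some (σ.clock q (σ.time i) + n) := by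
  induction j, hj using Nat.le_induction with
  | base =>
    obtain h' | ⟨inp, h'⟩ := config_succ σ i q
    · have h1 := h.1
      have h2 := h.2
      rw [view_eq_of_config_eq h'] at h2
      omega
    · have h2 := h.2
      rw [view_succ h'] at h2
      have h3 := h.1
      rw [deadline_succ_of_ne h' (by omega), h3]
  | succ j hj ih =>
    have hle := h.le_view hj
    have hm : view σ j q ≤ view σ (j + 1) q := view_mono q (Nat.le_succ j)
    have hvj : view σ j q = n := by omega
    obtain h' | ⟨inp, h'⟩ := config_succ σ j q
    · rw [h']
      exact ih hvj
    · rw [deadline_succ_of_eq h', ih hvj]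
      rw [view_succ h'] at hv
      omega

theorem view_succ_of_timeout {i : ℕ} {q : P} (h : σ.event i = .timeout q) :
    view σ (i + 1) q = view σ i q + 1 := by
  have h' : (σ.event i).action = some (q, Input.timeout) := by rw [h]; rfl
  rw [view_succ h']
  rfl

theorem view_lt_of_startsTimer {i : ℕ} {q : P} (h : σ.StartsTimer i q) :
    view σ i q < view σ (i + 1) q := by
  obtain ⟨o, ⟨inp, h1, rfl⟩, h2⟩ := h
  rw [view_succ h1]
  refine lt_of_le_of_ne view_le_nextView fun he => ?_
  have ht : ((algorithm R W Lead : Algorithm P V).step q (σ.config i q).state inp).timer = none :=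
    if_pos he.symm
  rw [ht] at h2
  exact absurd h2 (by simp)

/-- A process stays in view `n` for at least `n` units of its local clock. -/
theorem Enters.clock_le (hσ : σ.IsExecution) {i j n : ℕ} {q : P} (h : Enters σ i q n)
    (h' : Enters σ j q (n + 1)) : σ.clock q (σ.time i) + n ≤ σ.clock q (σ.time j) := by
  have hn : n ≠ 0 := by
    have := h.1
    omega
  have hv : view σ j q = n := by
    have := h'.1
    omega
  have hij := h.lt_of_le_view hv.ge
  have hd := h.deadline_eq hij hv
  obtain he | ⟨inp, he⟩ := config_succ σ j q
  · have h1 := h'.2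
    rw [view_eq_of_config_eq he] at h1
    omega
  · have h1 := h'.2
    rw [view_succ he] at h1
    obtain rfl := eq_timeout_of_nextView_ne (s := (σ.config j q).state) (inp := inp)
      (by simp only [view] at hv; omega) (by simp only [view] at hv; omega)
    obtain ⟨d, hd', hle⟩ := hσ.timeout_due j q (event_eq_timeout he)
    rw [hd] at hd'
    cases hd'
    exact hle

/-- After stabilization, a correct process leaves view `n` once `n` units have passed. -/
theorem Enters.exists_enters_succ {gst δ : ℝ} (hσ : σ.IsExecution)
    (hs : σ.SynchronousAfter gst δ) {i n : ℕ} {q : P} (hq : σ.Correct q) (h : Enters σ i q n)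
    {t : ℝ} (hgt : gst ≤ t) (hit : σ.time i ≤ t) (hc : σ.clock q (σ.time i) + n ≤ σ.clock q t) :
    ∃ j, Enters σ j q (n + 1) ∧ σ.time j ≤ t := by
  obtain ⟨j, hj, hjt, hor⟩ := hs.timer_prompt (i + 1) q _ t hq
    (h.deadline_eq (Nat.lt_succ_self i) h.2) hgt
    (fun j hj => (hσ.time_mono (Nat.lt_succ_iff.1 hj)).trans hit) hc
  have hlt : n + 1 ≤ view σ (j + 1) q := by
    have h1 := h.le_view (show i < j by omega)
    -- Expiry and restart of the timer both come with a change of view.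
    obtain ht | ht := hor
    · rw [view_succ_of_timeout ht]
      omega
    · have := view_lt_of_startsTimer ht
      omega
  obtain ⟨k, hk, hk'⟩ := exists_enters (Nat.succ_pos n) hlt
  exact ⟨k, hk', (hσ.time_mono (Nat.lt_succ_iff.1 hk)).trans hjt⟩

theorem exists_enters_of_correct {gst δ : ℝ} (hσ : σ.IsExecution)
    (hs : σ.SynchronousAfter gst δ) (hf : σ.Fair) (q : P) (n : ℕ) (hq : σ.Correct q) :
    ∃ j, Enters σ j q (n + 1) := by
  induction n with
  | zero =>
    obtain ⟨i, -, o, inp, h, -⟩ := hf q hq 0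
    have : 1 ≤ view σ (i + 1) q := by
      rw [view_succ h]
      exact nextView_pos
    obtain ⟨j, -, hj⟩ := exists_enters Nat.one_pos this
    exact ⟨j, hj⟩
  | succ n ih =>
    obtain ⟨i, hi⟩ := ih
    set d := σ.clock q (σ.time i) + ((n + 1 : ℕ) : ℝ)
    -- From `gst` on the clock runs at rate one, so it has reached `d` by the last of these times.
    set t := max (max gst (σ.time i)) (gst + (d - σ.clock q gst))
    have ht : gst ≤ t := (le_max_left _ _).trans (le_max_left _ _)
    have ht' : gst + (d - σ.clock q gst) ≤ t := le_max_right _ _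
    obtain ⟨j, hj, -⟩ := hi.exists_enters_succ hσ hs hq ht
      ((le_max_right _ _).trans (le_max_left _ _))
      (by rw [hs.clock_rate q t ht]; linarith)
    exact ⟨j, hj⟩

/-- After stabilization, view `n` of a correct process lasts exactly `n` units of time. -/
theorem Enters.time_eq {gst δ : ℝ} (hσ : σ.IsExecution) (hs : σ.SynchronousAfter gst δ)
    {i j n : ℕ} {q : P} (hq : σ.Correct q) (h : Enters σ i q n) (h' : Enters σ j q (n + 1))
    (hgt : gst ≤ σ.time i) : σ.time j = σ.time i + n := by
  have hij : i < j := h.lt_of_le_view (by have := h'.1; omega)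
  have hle := h.clock_le hσ h'
  rw [hs.clock_rate q _ hgt, hs.clock_rate q _ (hgt.trans (hσ.time_mono hij.le))] at hle
  refine le_antisymm ?_ (by linarith)
  have hn : (0 : ℝ) ≤ n := Nat.cast_nonneg n
  obtain ⟨k, hk, hkt⟩ := h.exists_enters_succ hσ hs hq (t := σ.time i + n) (by linarith)
    (by linarith) (by
      rw [hs.clock_rate q _ hgt, hs.clock_rate q (σ.time i + n) (by linarith)]
      linarith)
  obtain rfl : j = k := by
    have h1 := h'.lt_of_le_view hk.2.ge
    have h2 := hk.lt_of_le_view h'.2.ge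
    omega
  exact hkt

/-! ### Dissemination of facts -/

/-- Process `q` knows `a` after some event that occurs no later than `t`. -/
def KnowsBy (σ : Run (algorithm R W Lead : Algorithm P V)) (q : P) (a : Info P V) (t : ℝ) : Prop :=
  ∃ j, σ.time j ≤ t ∧ a ∈ known σ (j + 1) q

/-- Nobody learns `a` before time `gst`. -/
def FreshAfter (σ : Run (algorithm R W Lead : Algorithm P V)) (gst : ℝ) (a : Info P V) : Prop :=
  ∀ q j, a ∈ known σ (j + 1) q → gst ≤ σ.time j

theorem KnowsBy.mono {q : P} {a : Info P V} {t t' : ℝ} (h : KnowsBy σ q a t) (ht : t ≤ t') :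
    KnowsBy σ q a t' := by
  obtain ⟨j, hj, h⟩ := h
  exact ⟨j, hj.trans ht, h⟩

/-- Knowledge is sent only when it grows, so the message to follow is the one sent when `p` first
learns `a`. Freshness puts this event after `gst`, where delivery is timely. -/
theorem KnowsBy.send {gst δ : ℝ} (hσ : σ.IsExecution) (hs : σ.SynchronousAfter gst δ) {p q : P}
    (hp : σ.Correct p) (hq : σ.Correct q) (hpq : σ.ChannelCorrect p q) {a : Info P V} {t : ℝ}
    (ha : FreshAfter σ gst a) (h : KnowsBy σ p a t) : KnowsBy σ q a (t + δ) := by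
  classical
  have hex : ∃ j, a ∈ known σ (j + 1) p := h.imp fun _ h => h.2
  set j := Nat.find hex with hjdef
  have hj : a ∈ known σ (j + 1) p := Nat.find_spec hex
  have hjt : σ.time j ≤ t := by
    obtain ⟨k, hk, hka⟩ := h
    exact (hσ.time_mono (Nat.find_min' hex hka)).trans hk
  have hnot : a ∉ known σ j p := by
    rcases hj0 : j with _ | k
    · exact Set.notMem_empty a
    · exact Nat.find_min hex (show k < Nat.find hex by omega)
  obtain ⟨k, hk, hkt⟩ := hs.timely j p q _ hp hq hpq
    (sends_of_known_ne (fun he => hnot (he ▸ hj)) q) (ha p j hj)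
  refine ⟨k, by linarith, ?_⟩
  have hact : (σ.event k).action = some (q, Input.receive p (known σ (j + 1) p)) := by
    rw [hk]
    rfl
  rw [known_succ hact]
  exact subset_nextKnown (Or.inr hj)

theorem exists_delay_of_path {gst δ : ℝ} (hσ : σ.IsExecution) (hs : σ.SynchronousAfter gst δ)
    {f : FailurePattern P} (hf : σ.Compliant f) {p q : P} (h : f.Path p q) :
    ∃ N : ℝ, ∀ a, FreshAfter σ gst a → ∀ t, KnowsBy σ p a t → KnowsBy σ q a (t + N) := by
  obtain ⟨-, -, h⟩ := h
  induction h with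
  | refl => exact ⟨0, fun a _ t h => by rwa [add_zero]⟩
  | tail _ he ih =>
    obtain ⟨N, hN⟩ := ih
    obtain ⟨h1, h2, h3⟩ := he
    refine ⟨N + δ, fun a ha t h => ?_⟩
    rw [← add_assoc]
    refine (hN a ha t h).send hσ hs ?_ ?_ ?_ ha
    · exact not_not.1 fun hc => h1 (hf.1 _ hc)
    · exact not_not.1 fun hc => h2 (hf.1 _ hc)
    · by_contra hc
      rcases hf.2 _ _ hc with h | h | h
      exacts [h3 h, h1 h, h2 h]

/-- A uniform bound on the time in which facts travel along paths of the residual graph. -/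
theorem exists_delay [Finite P] {gst δ : ℝ} (hσ : σ.IsExecution) (hs : σ.SynchronousAfter gst δ)
    {f : FailurePattern P} (hf : σ.Compliant f) :
    ∃ N : ℝ, 0 ≤ N ∧ ∀ p q, f.Path p q → ∀ a, FreshAfter σ gst a → ∀ t,
      KnowsBy σ p a t → KnowsBy σ q a (t + N) := by
  have h : ∀ p q : P, ∃ N : ℝ, f.Path p q → ∀ a, FreshAfter σ gst a → ∀ t,
      KnowsBy σ p a t → KnowsBy σ q a (t + N) := by
    intro p q
    by_cases hpq : f.Path p q
    · exact (exists_delay_of_path hσ hs hf hpq).imp fun N h _ => h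
    · exact ⟨0, fun h => absurd h hpq⟩
  choose N hN using h
  obtain ⟨B, hB⟩ := (Set.finite_range fun x : P × P => N x.1 x.2).bddAbove
  refine ⟨max B 0, le_max_right _ _, fun p q hpq a ha t h => ?_⟩
  have : N p q ≤ B := hB ⟨(p, q), rfl⟩
  exact (hN p q hpq a ha t h).mono (by linarith [le_max_left B 0])

theorem freshAfter_of_le_view {gst : ℝ} (hσ : σ.IsExecution) {a : Info P V} {n i : ℕ} {p : P}
    (ha : ∀ q j, a ∈ known σ j q → n ≤ view σ j p) (h : Enters σ i p n) (hi : gst ≤ σ.time i) :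
    FreshAfter σ gst a := fun q _ hj =>
  hi.trans (hσ.time_mono (Nat.lt_succ_iff.1 (h.lt_of_le_view (ha q _ hj))))

/-- There is a last event that occurs no later than a given time. -/
theorem exists_last_event (hσ : σ.IsExecution) {i : ℕ} {t : ℝ} (hi : σ.time i ≤ t) :
    ∃ j, σ.time j ≤ t ∧ ∀ k, σ.time k ≤ t → k ≤ j := by
  obtain ⟨m, hm⟩ := (hσ.time_unbounded.eventually_gt_atTop t).exists
  have hlt : ∀ k, σ.time k ≤ t → k ≤ m := fun k hk => by
    by_contra! h
    exact absurd (hσ.time_mono h.le) (by linarith)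
  exact ⟨Nat.findGreatest (fun k => σ.time k ≤ t) m,
    Nat.findGreatest_spec (P := fun k => σ.time k ≤ t) (hlt i hi) hi,
    fun k hk => Nat.le_findGreatest (hlt k hk) hk⟩

/-! ### Termination -/

/-- If the operation at `p` never returned, `p` would stay pending. In a long enough view led by
`p`, three journeys of facts (entries to `p`, proposal to `w`, votes to `p`) let `p` know a
decision, which a pending process never does. -/
theorem algorithm_waitFree [Finite P] (hR : ∀ r ∈ R, r.Nonempty)
    (hL : ∀ p q n, Lead p n → Lead q n → p = q) (hLead : ∀ p M, ∃ n ≥ M, Lead p n)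
    {f : FailurePattern P} {r w : Set P} (hr : r ∈ R) (hw : w ∈ W) {T : Set P}
    (hrT : ∀ p ∈ T, ∀ q ∈ r, f.Path q p) (hwT : ∀ p ∈ T, ∀ q ∈ w, f.Path p q ∧ f.Path q p) :
    (algorithm R W Lead : Algorithm P V).WaitFree f T := by
  rintro σ hσ - ⟨gst, δ, -, hs⟩ hfair hf p hpT i x hi
  by_contra! hno
  obtain ⟨N, hN0, hN⟩ := exists_delay hσ hs hf
  have hcor : ∀ q, q ∉ f.procs → σ.Correct q := fun q hq => not_not.1 fun hc => hq (hf.1 _ hc)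
  obtain ⟨q₀, hq₀⟩ := hR r hr
  have hp : σ.Correct p := hcor p (hrT p hpT q₀ hq₀).2.1
  choose! e he using exists_enters_of_correct hσ hs hfair
  have hmono : ∀ q, σ.Correct q → StrictMono (e q) := fun q hq =>
    strictMono_nat_of_lt_succ fun n =>
      (he q n hq).lt_of_le_view (by have := (he q (n + 1) hq).1; omega)
  -- `n₀` is an event index that also serves as a view bound: `e q n`, the entry of `q` into view `n
  -- + 1`, has index at least `n`.
  obtain ⟨n₀, hn₀⟩ := Filter.eventually_atTop.1 (hσ.time_unbounded.eventually_ge_atTop gst)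
  have hgst : ∀ q, σ.Correct q → ∀ n ≥ n₀, gst ≤ σ.time (e q n) := fun q hq n hn =>
    hn₀ _ (hn.trans ((hmono q hq).le_apply))
  have hstep : ∀ q, σ.Correct q → ∀ n ≥ n₀,
      σ.time (e q (n + 1)) = σ.time (e q n) + ((n + 1 : ℕ) : ℝ) := fun q hq n hn =>
    (he q n hq).time_eq hσ hs hq (he q (n + 1) hq) (hgst q hq n hn)
  -- `C` bounds the skew at one view; equal durations preserve it from there on. The arbitrary
  -- values of `e` at faulty processes do no harm.
  obtain ⟨C, hC⟩ := (Set.finite_range fun y : P × P =>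
    σ.time (e y.1 n₀) - σ.time (e y.2 n₀)).bddAbove
  have hdiff : ∀ q q', σ.Correct q → σ.Correct q' → ∀ n ≥ n₀,
      σ.time (e q n) - σ.time (e q' n) ≤ C := by
    intro q q' hq hq' n hn
    induction n, hn using Nat.le_induction with
    | base => exact hC ⟨(q, q'), rfl⟩
    | succ n hn ih =>
      rw [hstep q hq n hn, hstep q' hq' n hn]
      linarith
  have hC0 : 0 ≤ C := by simpa using hdiff p p hp hp n₀ le_rfl
  -- Entries happen within `C` of `t` on either side, which costs `2 * C`, and each journey costs
  -- `N`. The votes may reach `p` after the view has ended.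
  obtain ⟨M, hM⟩ := exists_nat_ge (2 * C + 3 * N)
  obtain ⟨n', hn', hlead⟩ := hLead p (max (max M n₀) (i + 1) + 1)
  obtain ⟨n, rfl⟩ : ∃ n, n' = n + 1 := ⟨n' - 1, by omega⟩
  have hnM : M ≤ n := by omega
  have hnn₀ : n₀ ≤ n := by omega
  have hni : i < n := by omega
  have hnR : 2 * C + 3 * N ≤ (n : ℝ) := hM.trans (by exact_mod_cast hnM)
  set t := σ.time (e p n) with ht
  have hleave : ∀ q, σ.Correct q → t + C + 2 * N < σ.time (e q (n + 1)) := by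
    intro q hq
    rw [hstep q hq n hnn₀]
    have := hdiff p q hp hq n hnn₀
    push_cast
    linarith
  have hview : ∀ q j, σ.Correct q → σ.time j ≤ t + C + 2 * N → e q n ≤ j →
      view σ (j + 1) q = n + 1 := fun q j hq hj hle =>
    view_eq_of_le (he q n hq) (he q (n + 1) hq) (Nat.lt_succ_of_le hle) (by
      by_contra! h
      exact absurd (hσ.time_mono (Nat.lt_succ_iff.1 h)) (by linarith [hleave q hq]))
  have henter : ∀ q, σ.Correct q → σ.time (e q n) ≤ t + C := fun q hq => by
    linarith [hdiff q p hq hp n hnn₀]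
  -- the leader learns that the read quorum has entered its view, and proposes
  have h1 : ∀ q ∈ r, KnowsBy σ p (enter q (n + 1)) (t + C + N) := by
    intro q hq
    have hqc := hcor q (hrT p hpT q hq).1
    refine hN q p (hrT p hpT q hq) _ (freshAfter_of_le_view hσ
      (fun q' j hj => le_view_of_enter hσ hj) (he q n hqc) (hgst q hqc n hnn₀)) _
      ⟨e q n, henter q hqc, ?_⟩
    have h2 := (he q n hqc).2
    have h3 := enter_mem_known (σ := σ) (i := e q n + 1) (q := q) (by omega)
    rwa [h2] at h3
  -- By the last event up to this time `p` has gathered all the entries at once, and it is still in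
  -- the view.
  obtain ⟨j, hj, hjmax⟩ := exists_last_event hσ (i := e p n) (t := t + C + N) (by linarith)
  have hjv : view σ (j + 1) p = n + 1 :=
    hview p j hp (by linarith) (hjmax _ (by linarith))
  obtain ⟨y, hy⟩ : ∃ y, prop (n + 1) y ∈ known σ (j + 1) p := by
    rw [← hjv]
    refine exists_prop_of_lead hR (hjv ▸ hlead) (pending_isSome_of_invoke hi hno ?_)
      ⟨r, hr, fun q hq => ?_⟩
    · have := (hmono p hp).le_apply (x := n)
      have := hjmax (e p n) (by linarith)
      omega
    · rw [hjv]
      obtain ⟨k, hk, hka⟩ := h1 q hq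
      exact known_mono p (Nat.succ_le_succ (hjmax k hk)) hka
  -- the write quorum votes for the proposal
  have h2 : ∀ q ∈ w, KnowsBy σ q (vote q (n + 1) y) (t + C + 2 * N) := by
    intro q hq
    have hqc := hcor q (hwT p hpT q hq).1.2.1
    obtain ⟨k, hk, hka⟩ := hN p q (hwT p hpT q hq).1 _ (freshAfter_of_le_view hσ
      (fun q' j hj => le_view_of_prop hL hσ hlead hj) (he p n hp) (hgst p hp n hnn₀)) _
      ⟨j, hj, hy⟩
    -- A vote needs both the proposal and presence in the view, whichever comes later.
    have hm : σ.time (max k (e q n)) ≤ t + C + 2 * N := by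
      rcases max_choice k (e q n) with h | h <;> rw [h]
      · linarith
      · linarith [henter q hqc]
    have hv := hview q _ hqc hm (le_max_right _ _)
    refine ⟨_, hm, ?_⟩
    rw [← hv]
    refine vote_mem_known_of_prop ?_
    rw [hv]
    exact known_mono q (Nat.succ_le_succ (le_max_left _ _)) hka
  -- the leader learns the votes
  have h3 : ∀ q ∈ w, KnowsBy σ p (vote q (n + 1) y) (t + C + 3 * N) := by
    intro q hq
    have hqc := hcor q (hwT p hpT q hq).1.2.1
    refine (hN q p (hwT p hpT q hq).2 _ (freshAfter_of_le_view hσ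
      (fun q' j hj => le_view_of_vote hσ hj) (he q n hqc) (hgst q hqc n hnn₀)) _ (h2 q hq)).mono ?_
    linarith
  obtain ⟨k, -, hkmax⟩ := exists_last_event hσ (i := j) (t := t + C + 3 * N) (by linarith)
  have hjk : j ≤ k := hkmax j (by linarith)
  refine not_decided_of_pending (pending_isSome_of_invoke hi hno (k := k + 1) ?_) y
    ⟨n + 1, known_mono p (Nat.succ_le_succ hjk) hy, w, hw, fun q hq => ?_⟩
  · have := (hmono p hp).le_apply (x := n)
    have := hjmax (e p n) (by linarith)
    omega
  · obtain ⟨l, hl, hla⟩ := h3 q hq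
    exact known_mono p (Nat.succ_le_succ (hkmax l hl)) hla

end Run

end Paxos

/-! ### Quorum paths and leader rotation -/

theorem FailurePattern.Path.trans {P : Type u} {f : FailurePattern P} {p q s : P}
    (h : f.Path p q) (h' : f.Path q s) : f.Path p s :=
  ⟨h.1, h'.2.1, h.2.2.trans h'.2.2⟩

/-- Some failure pattern is needed to provide a write quorum that `r` must meet. -/
theorem IsGeneralizedQuorumSystem.nonempty {P : Type u} {F : Set (FailurePattern P)}
    {R W : Set (Set P)} (h : IsGeneralizedQuorumSystem F R W) {f : FailurePattern P} (hf : f ∈ F)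
    {r : Set P} (hr : r ∈ R) : r.Nonempty := by
  obtain ⟨w, hw, -⟩ := h.availability f hf
  exact (h.consistency r hr w hw).mono Set.inter_subset_left

/-- Round-robin leader election. -/
theorem exists_rotating_leader (P : Type u) [Finite P] :
    ∃ Lead : P → ℕ → Prop, (∀ p q n, Lead p n → Lead q n → p = q) ∧
      ∀ p M, ∃ n ≥ M, Lead p n := by
  obtain ⟨k, ⟨e⟩⟩ := Finite.exists_equiv_fin P
  refine ⟨fun p n => n % k = e p, fun p q n hp hq => e.injective (Fin.ext (hp.symm.trans hq)),
    fun p M => ⟨e p + k * M, ?_, ?_⟩⟩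
  · have : 0 < k := (Nat.zero_le _).trans_lt (e p).isLt
    exact (Nat.le_mul_of_pos_left M this).trans (Nat.le_add_left _ _)
  · change (e p + k * M) % k = e p
    rw [Nat.add_mul_mod_self_left, Nat.mod_eq_of_lt (e p).isLt]

/-- All processes of the termination component have paths to a common available write quorum
and back, and from a common read quorum. -/
theorem exists_quorums_of_terminationComponent {P : Type u} {F : Set (FailurePattern P)}
    {R W : Set (Set P)} (h : IsGeneralizedQuorumSystem F R W) {f : FailurePattern P}
    (hf : f ∈ F) : ∃ r ∈ R, ∃ w ∈ W, ∀ p ∈ terminationComponent R W f,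
      (∀ q ∈ r, f.Path q p) ∧ ∀ q ∈ w, f.Path p q ∧ f.Path q p := by
  obtain ⟨w, hw, r, hr, hav, hre⟩ := h.availability f hf
  refine ⟨r, hr, w, hw, ?_⟩
  rintro p ⟨q, ⟨w', hw', hav', ⟨r', hr', hre'⟩, hq⟩, hpq, hqp⟩
  -- Crosswise intersections link the two pairs: `s` leads from `w` into `w'` as a member of `r'`,
  -- and `s'` leads from `w'` into `w` as a member of `r`.
  obtain ⟨s, hsr', hsw⟩ := h.consistency r' hr' w hw
  obtain ⟨s', hsr, hsw'⟩ := h.consistency r hr w' hw'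
  have hsp : f.Path s p := (hre'.2.2 s hsr' q hq).trans hqp
  have hps : f.Path p s := hpq.trans ((hav'.2 q hq s' hsw').trans (hre.2.2 s' hsr s hsw))
  exact ⟨fun z hz => (hre.2.2 z hz s hsw).trans hsp,
    fun z hz => ⟨hps.trans (hav.2 s hsw z hz), (hav.2 z hz s hsw).trans hsp⟩⟩

end GQS

theorem theorem7p1 {P : Type*} [Finite P] {V : Type*}
    (F : Set (GQS.FailurePattern P)) (R W : Set (Set P))
    (h : GQS.IsGeneralizedQuorumSystem F R W)
    (τ : F → Set P) (hτ : ∀ f : F, τ f = GQS.terminationComponent R W f) :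
    ∃ A : GQS.Algorithm P V, A.ImplementsConsensus ∧ A.SystemWaitFree F τ := by
  obtain ⟨Lead, hL, hLead⟩ := GQS.exists_rotating_leader P
  refine ⟨GQS.Paxos.algorithm R W Lead,
    GQS.Paxos.algorithm_implementsConsensus h.consistency hL, fun f => ?_⟩
  obtain ⟨r, hr, w, hw, hrw⟩ := GQS.exists_quorums_of_terminationComponent h f.2
  exact GQS.Paxos.algorithm_waitFree (fun _ => h.nonempty f.2) hL hLead hr hw
    (fun p hp => (hrw p (hτ f ▸ hp)).1) fun p hp => (hrw p (hτ f ▸ hp)).2
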